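/- Let $R$ be a commutative ring with $1$ which is local, i.e. has a unique maximal ideal $\mathcal{M}$ ($R$ is not assumed Noetherian). For $x\in R$ put $\mathrm{Ann}(x)=\{a\in R : ax=0\}$. A cyclic module is a module generated by one element (it may be zero); a simple module is a nonzero module whose only submodules are $0$ and itself, so the zero module is not simple. Then the following statements are equivalent: (1) $\mathcal{M}$ is finitely generated and every ideal of $R$ is a direct sum of cyclic $R$-modules. (2) $R$ is Noetherian and every ideal of $R$ is a direct sum of cyclic $R$-modules. (3) There exist a positive integer $n$ and elements $v_1,\dots,v_n\in R$ such that $\mathcal{M}=Rv_1\oplus\cdots\oplus Rv_n$, each $R/\mathrm{Ann}(v_i)$ is a principal ideal ring, and at most two of the $Rv_i$ are not simple. (4) There exists a positive integer $n$ such that every ideal $I$ of $R$ is of the form $I=Rv_1\oplus\cdots\oplus Rv_m$ with $m\le n$, $v_1,\dots,v_m\in R$, and at most two of the $Rv_i$ not simple. (5) There exists a positive integer $n$ such that every ideal of $R$ is a direct sum of at most $n$ cyclic $R$-modules. (6) There exists a positive integer $n$ such that every ideal of $R$ is (isomorphic to) a direct summand of a direct sum of at most $n$ cyclic $R$-modules.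 Moreover, the integer $n$ can be taken to be the same in (3)-(6), and it bounds all decompositions: for every positive integer $n$, the conditions on $n$ in (4), (5) and (6) are equivalent to each other, and they are equivalent to the condition in (3) holding for some positive integer $k\le n$; and if they hold, then whenever an ideal of $R$ is written as a direct sum $\bigoplus_{i\in\iota}Rv_i$ with all $v_i\neq 0$, the index set $\iota$ is finite with at most $n$ elements. -/

import Mathlib

universe u v

/-- `P` is the internal direct sum of the family `N` of submodules of `M`. -/
def IsDirectSumOf {R : Type*} [Ring R] {M : Type*} [AddCommGroup M] [Module R M] {ι : Type*}
    (P : Submodule R M) (N : ι → Submodule R M) : Prop :=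
  iSupIndep N ∧ ⨆ i, N i = P

/-- The module `M` is a direct sum (of any number) of cyclic modules. Zero summands may always be
dropped, so that index types in the universe of `M` suffice. -/
def IsDirectSumOfCyclics (R : Type u) [Ring R] (M : Type v) [AddCommGroup M] [Module R M] :
    Prop :=
  ∃ (ι : Type v) (N : ι → Submodule R M),
    (∀ i, (N i).IsPrincipal) ∧ IsDirectSumOf ⊤ N

/-- The module `M` is a direct sum of at most `n` cyclic modules. -/
def IsDirectSumOfAtMostCyclics (R : Type u) [Ring R] (n : ℕ) (M : Type v) [AddCommGroup M]
    [Module R M] : Prop :=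
  ∃ m ≤ n, ∃ N : Fin m → Submodule R M, (∀ i, (N i).IsPrincipal) ∧ IsDirectSumOf ⊤ N

/-- The module `M` is isomorphic to a direct summand of a direct sum of at most `n` cyclic
modules. A cyclic `R`-module is a quotient of `R`, so that the universe of `R` suffices for the
ambient module `P`. -/
def IsSummandOfAtMostCyclics (R : Type u) [Ring R] (n : ℕ) (M : Type v) [AddCommGroup M]
    [Module R M] : Prop :=
  ∃ (P : Type u) (_ : AddCommGroup P) (_ : Module R P), IsDirectSumOfAtMostCyclics R n P ∧
    ∃ S T : Submodule R P, IsCompl S T ∧ Nonempty (M ≃ₗ[R] S)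

/-- `I = R v₁ ⊕ ⋯ ⊕ R vₘ` (an internal direct sum), and at most two of the `R vᵢ` are not
simple. The zero module counts as not simple. -/
def IsDecomposition {R : Type*} [CommRing R] (I : Ideal R) {m : ℕ} (v : Fin m → R) : Prop :=
  IsDirectSumOf I (fun i => Ideal.span {v i}) ∧
    {i | ¬ IsSimpleModule R (Ideal.span {v i})}.ncard ≤ 2

/-- The maximal ideal is `R v₁ ⊕ ⋯ ⊕ R vₙ`, every `R / Ann(vᵢ)` is a principal ideal ring and at
most two of the `R vᵢ` are not simple. Here `Ideal.torsionOf R R x` is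
`Ann(x) = {a | a * x = 0}`. -/
def MaximalIdealDecomposes (R : Type*) [CommRing R] [IsLocalRing R] (n : ℕ) : Prop :=
  ∃ v : Fin n → R, IsDecomposition (IsLocalRing.maximalIdeal R) v ∧
    ∀ i, IsPrincipalIdealRing (R ⧸ Ideal.torsionOf R R (v i))

/-! Write $\mathcal M=\bigoplus Rv_i$. Each $v_iv_j$ with $i\ne j$ lies in $Rv_i\cap Rv_j=0$, so
$\mathcal M v_i=Rv_i^2$, and a nonzero $Rv_i$ is simple as soon as $v_i^2=0$. If $x,y,z$ were three
of the $v_i$ with nonzero squares, the ideal $(x+y,x+z)$ could not be a direct sum of cyclics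
(`false_of_three_mul_self_ne_zero`). Moreover $\mathcal M x=Rx^2$ makes every element of $Rx$ a unit
times a power of $x$, up to $\bigcap Rx^i$; a Nakayama argument kills this intersection, so the
submodules of $Rx$ are cyclic (`isPrincipal_of_le_span_singleton`). This gives (3).

Conversely, let $\mathcal M=Rx\oplus Ry\oplus S$ with $\mathcal M S=0$. The projections of an ideal
$I\subseteq\mathcal M$ to $Rx$ and $Ry$ are cyclic, and lifting their generators to $I$ gives
$I=Ra\oplus Rb\oplus(I\cap S)$ (`exists_decomposition_of_le_maximalIdeal`), where $I\cap S$ is a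
residue field vector space.

Direct summands are handled by Krull–Schmidt exchange, since $\mathrm{End}(R/J)=R/J$ is local or
zero. The bound $n$ is linear algebra over the residue field. -/

section CyclicDecompositions

open Submodule IsLocalRing

/-! ### Independent families of cyclic submodules -/

section Families

variable {R : Type*} [Ring R] {M : Type*} [AddCommGroup M] [Module R M] {ι : Type*}

/-- The sum of the cyclic submodules `R vᵢ` is direct, in terms of elements. -/
def CyclicIndep (R : Type*) [Ring R] {M : Type*} [AddCommGroup M] [Module R M] {ι : Type*}
    (v : ι → M) : Prop :=
  ∀ c : ι →₀ R, Finsupp.linearCombination R v c = 0 → ∀ i, c i • v i = 0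

theorem iSupIndep_span_singleton_iff {v : ι → M} :
    iSupIndep (fun i => span R {v i}) ↔ CyclicIndep R v := by
  have key : ∀ i, (⨆ (j) (_ : j ≠ i), span R {v j}) = span R (v '' {j | j ≠ i}) := by
    intro i
    rw [Set.image_eq_iUnion, span_iUnion₂]
    rfl
  classical
  simp only [iSupIndep_def, key]
  constructor
  · intro h c hc i
    refine disjoint_def.1 (h i) _ (smul_mem _ _ (mem_span_singleton_self _)) ?_
    have h1 := Finsupp.single_add_erase i c
    rw [← h1, map_add, Finsupp.linearCombination_single] at hc
    rw [eq_neg_of_add_eq_zero_left hc]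
    refine neg_mem ((Finsupp.mem_span_image_iff_linearCombination R).2
      ⟨_, ?_, rfl⟩)
    rw [Finsupp.mem_supported]
    intro j hj
    simp only [Finsupp.support_erase, Finset.coe_erase] at hj
    exact hj.2
  · intro h i
    rw [disjoint_def]
    intro x hx hx'
    obtain ⟨a, rfl⟩ := mem_span_singleton.1 hx
    obtain ⟨l, hl, hl'⟩ := (Finsupp.mem_span_image_iff_linearCombination R).1 hx'
    have h0 := h (Finsupp.single i a - l) (by simp [hl']) i
    have hli : l i = 0 := by
      by_contra hne
      exact ((Finsupp.mem_supported R l).1 hl (Finsupp.mem_support_iff.2 hne)) rfl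
    simpa [hli] using h0

theorem isDirectSumOf_span_singleton_iff {P : Submodule R M} {v : ι → M} :
    IsDirectSumOf P (fun i => span R {v i}) ↔ CyclicIndep R v ∧ span R (Set.range v) = P := by
  rw [IsDirectSumOf, iSupIndep_span_singleton_iff, span_range_eq_iSup]

theorem cyclicIndep_iff_fintype [Fintype ι] {v : ι → M} :
    CyclicIndep R v ↔ ∀ c : ι → R, ∑ i, c i • v i = 0 → ∀ i, c i • v i = 0 := by
  constructor
  · intro h c hc i
    have := h (Finsupp.equivFunOnFinite.symm c)
      (by simpa [Finsupp.linearCombination_apply, Finsupp.sum_fintype] using hc) i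
    simpa using this
  · intro h c hc i
    refine h c ?_ i
    rwa [Finsupp.linearCombination_apply, Finsupp.sum_fintype _ _ (by simp)] at hc

theorem CyclicIndep.comp {κ : Type*} {v : ι → M} (h : CyclicIndep R v) {f : κ → ι}
    (hf : Function.Injective f) : CyclicIndep R (v ∘ f) := by
  rw [← iSupIndep_span_singleton_iff] at h ⊢
  exact h.comp hf

theorem CyclicIndep.map {M' : Type*} [AddCommGroup M'] [Module R M'] {v : ι → M}
    (h : CyclicIndep R v) {f : M →ₗ[R] M'} (hf : Function.Injective f) :
    CyclicIndep R (f ∘ v) := by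
  intro c hc i
  have := h c (hf (by rw [map_zero, Finsupp.apply_linearCombination, hc])) i
  simpa using congrArg f this

theorem CyclicIndep.of_map {M' : Type*} [AddCommGroup M'] [Module R M'] {v : ι → M}
    {f : M →ₗ[R] M'} (hf : Function.Injective f) (h : CyclicIndep R (f ∘ v)) :
    CyclicIndep R v := by
  intro c hc i
  apply hf
  simpa using h c (by rw [← Finsupp.apply_linearCombination, hc, map_zero]) i

theorem isPrincipal_family_eq {N : ι → Submodule R M} (h : ∀ i, (N i).IsPrincipal) :
    ∃ v : ι → M, N = fun i => span R {v i} := by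
  choose v hv using fun i => (h i).principal
  exact ⟨v, funext hv⟩

/-- A module is a direct sum of at most `n` cyclic modules as soon as it is the sum of an
independent family of cyclic submodules indexed by a type with at most `n` elements. -/
theorem IsDirectSumOfAtMostCyclics.of_cyclicIndep [Finite ι] {v : ι → M} {n : ℕ}
    (hn : Nat.card ι ≤ n) (h : CyclicIndep R v) (ht : span R (Set.range v) = ⊤) :
    IsDirectSumOfAtMostCyclics R n M := by
  let e := (Finite.equivFin ι).symm
  refine ⟨Nat.card ι, hn, fun i => span R {v (e i)}, fun i => ⟨_, rfl⟩, ?_⟩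
  refine (isDirectSumOf_span_singleton_iff (v := v ∘ e)).2 ⟨h.comp e.injective, ?_⟩
  rw [Set.range_comp, e.range_eq_univ, Set.image_univ, ht]

theorem IsDirectSumOfAtMostCyclics.exists_cyclicIndep {n : ℕ}
    (h : IsDirectSumOfAtMostCyclics R n M) :
    ∃ m ≤ n, ∃ v : Fin m → M, CyclicIndep R v ∧ span R (Set.range v) = ⊤ := by
  obtain ⟨m, hm, N, hN, hd⟩ := h
  obtain ⟨v, rfl⟩ := isPrincipal_family_eq hN
  exact ⟨m, hm, v, isDirectSumOf_span_singleton_iff.1 hd⟩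

theorem IsDirectSumOfAtMostCyclics.submodule_of_cyclicIndep [Finite ι] {P : Submodule R M}
    {v : ι → M} {n : ℕ} (hn : Nat.card ι ≤ n) (h : CyclicIndep R v)
    (ht : span R (Set.range v) = P) : IsDirectSumOfAtMostCyclics R n P := by
  have hv : ∀ i, v i ∈ P := fun i => ht ▸ subset_span ⟨i, rfl⟩
  let w : ι → P := fun i => ⟨v i, hv i⟩
  have hw : P.subtype ∘ w = v := rfl
  refine .of_cyclicIndep (v := w) hn (.of_map P.injective_subtype (hw ▸ h)) ?_
  apply map_injective_of_injective P.injective_subtype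
  rw [map_span, ← Set.range_comp, hw, ht, map_subtype_top]

theorem IsDirectSumOfAtMostCyclics.exists_submodule_cyclicIndep {P : Submodule R M} {n : ℕ}
    (h : IsDirectSumOfAtMostCyclics R n P) :
    ∃ m ≤ n, ∃ v : Fin m → M, CyclicIndep R v ∧ span R (Set.range v) = P := by
  obtain ⟨m, hm, v, hv, ht⟩ := h.exists_cyclicIndep
  refine ⟨m, hm, _, hv.map P.injective_subtype, ?_⟩
  rw [Set.range_comp, ← map_span, ht, map_subtype_top]

end Families

/-! ### Direct sums of cyclic modules -/

section Modules

theorem IsDirectSumOfAtMostCyclics.isDirectSumOfCyclics {R : Type u} [Ring R] {M : Type v}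
    [AddCommGroup M] [Module R M] {n : ℕ} (h : IsDirectSumOfAtMostCyclics R n M) :
    IsDirectSumOfCyclics R M := by
  obtain ⟨m, -, v, hv, ht⟩ := h.exists_cyclicIndep
  exact ⟨ULift (Fin m), fun i => span R {v i.down}, fun i => ⟨_, rfl⟩,
    isDirectSumOf_span_singleton_iff (v := v ∘ ULift.down) |>.2
      ⟨hv.comp ULift.down_injective, by
        rw [Set.range_comp, ULift.down_surjective.range_eq, Set.image_univ, ht]⟩⟩

theorem IsDirectSumOfAtMostCyclics.finite {R : Type u} [Ring R] {M : Type v}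
    [AddCommGroup M] [Module R M] {n : ℕ} (h : IsDirectSumOfAtMostCyclics R n M) :
    Module.Finite R M := by
  obtain ⟨m, -, v, -, ht⟩ := h.exists_cyclicIndep
  exact ⟨⟨Set.finite_range v |>.toFinset, by simpa using ht⟩⟩

theorem IsDirectSumOfAtMostCyclics.isSummandOfAtMostCyclics {R : Type u} [Ring R] {M : Type u}
    [AddCommGroup M] [Module R M] {n : ℕ} (h : IsDirectSumOfAtMostCyclics R n M) :
    IsSummandOfAtMostCyclics R n M :=
  ⟨M, _, _, h, ⊤, ⊥, isCompl_top_bot, ⟨(Submodule.topEquiv).symm⟩⟩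

/-- Zero summands can be dropped. -/
theorem IsDirectSumOfCyclics.exists_submodule_cyclicIndep {R : Type u} [Ring R] {M : Type v}
    [AddCommGroup M] [Module R M] {P : Submodule R M} (h : IsDirectSumOfCyclics R P) :
    ∃ (ι : Type v) (v : ι → M), (∀ i, v i ≠ 0) ∧ CyclicIndep R v ∧ span R (Set.range v) = P := by
  obtain ⟨ι, N, hN, hd⟩ := h
  obtain ⟨w, rfl⟩ := isPrincipal_family_eq hN
  obtain ⟨hw, ht⟩ := isDirectSumOf_span_singleton_iff.1 hd
  let v : {i // (w i : M) ≠ 0} → M := fun i => w i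
  refine ⟨_, v, fun i => i.2, (hw.map P.injective_subtype).comp Subtype.val_injective, ?_⟩
  refine le_antisymm (span_le.2 ?_) ?_
  · rintro _ ⟨i, rfl⟩
    exact (w i).2
  · have h1 := congrArg (Submodule.map P.subtype) ht
    rw [map_span, map_subtype_top] at h1
    refine h1.symm.trans_le (span_le.2 ?_)
    rintro _ ⟨_, ⟨i, rfl⟩, rfl⟩
    by_cases h0 : (w i : M) = 0
    · simp [h0]
    · exact subset_span ⟨⟨i, h0⟩, rfl⟩

end Modules

/-! ### The number of nonzero cyclic summands -/

section Bound

variable {R : Type*} [CommRing R] [IsLocalRing R]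

/-- A unit multiple of a nonzero element is nonzero. -/
theorem mem_maximalIdeal_of_smul_eq_zero {M : Type*} [AddCommGroup M] [Module R M] {a : R} {x : M}
    (hx : x ≠ 0) (h : a • x = 0) : a ∈ maximalIdeal R := by
  rw [mem_maximalIdeal, mem_nonunits_iff]
  intro hu
  exact hx ((hu.smul_eq_zero).1 h)

/-- If a module over a local ring is generated by `n` elements, an independent family of nonzero
cyclic submodules with sum the whole module has at most `n` members. -/
theorem CyclicIndep.finite_card_le {M : Type*} [AddCommGroup M] [Module R M] {ι : Type*} {n : ℕ}
    {v : ι → M} {w : Fin n → M} (hv : CyclicIndep R v) (h0 : ∀ i, v i ≠ 0)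
    (h : span R (Set.range v) = span R (Set.range w)) : Finite ι ∧ Nat.card ι ≤ n := by
  have h1 : ∀ i, ∃ c : Fin n → R, ∑ j, c j • w j = v i := fun i =>
    (mem_span_range_iff_exists_fun R).1 (h ▸ subset_span ⟨i, rfl⟩)
  have h2 : ∀ j, ∃ c : ι →₀ R, Finsupp.linearCombination R v c = w j := fun j =>
    (Finsupp.mem_span_range_iff_exists_finsupp).1 (h ▸ subset_span ⟨j, rfl⟩)
  choose A hA using h1
  choose B hB using h2
  let k := ResidueField R
  let g : (Fin n → k) →ₗ[k] (ι →₀ k) :=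
    Fintype.linearCombination k fun j => (B j).mapRange (residue R) (map_zero _)
  let a : ι → Fin n → k := fun i j => residue R (A i j)
  -- The transition matrices satisfy $AB\equiv 1$ modulo $\mathcal M$, because the annihilator of
  -- each nonzero `v l` lies in $\mathcal M$. So the rows of $A$ are independent in $k^n$.
  have hg : g ∘ a = fun i => Finsupp.single i (1 : k) := by
    funext i
    ext l
    have h3 := hv (∑ j, A i j • B j - Finsupp.single i 1) (by simp [hB, hA]) l
    have h4 := mem_maximalIdeal_of_smul_eq_zero (h0 l) h3
    rw [← residue_eq_zero_iff] at h4
    classical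
    simp only [Finsupp.coe_sub, Finsupp.coe_finsetSum, Pi.sub_apply, Finset.sum_apply, map_sub,
      sub_eq_zero, map_sum, Finsupp.smul_apply, smul_eq_mul, map_mul] at h4
    simp only [g, a, Function.comp_apply, Fintype.linearCombination_apply,
      Finsupp.coe_finsetSum, Finset.sum_apply, Finsupp.smul_apply, Finsupp.mapRange_apply,
      smul_eq_mul, h4, Finsupp.single_apply]
    split_ifs <;> simp
  have hli : LinearIndependent k a :=
    .of_comp g (hg ▸ Finsupp.linearIndependent_single_one k ι)
  have hfin : Finite ι := hli.finite
  refine ⟨hfin, ?_⟩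
  have := Fintype.ofFinite ι
  rw [Nat.card_eq_fintype_card]
  simpa using hli.fintype_card_le_finrank

end Bound

/-! ### Exchange property and direct summands -/

section KrullSchmidt

/-- The exchange property: if `A × B ≃ C × Q` and the composite `C → A → C` is bijective, then `C`
splits off `A`, and it can be cancelled. -/
theorem exists_equiv_of_bijective_comp {R A B C Q : Type*} [Ring R] [AddCommGroup A] [Module R A]
    [AddCommGroup B] [Module R B] [AddCommGroup C] [Module R C] [AddCommGroup Q] [Module R Q]
    (e : (A × B) ≃ₗ[R] C × Q)
    (h : Function.Bijective fun c : C => (e ((e.symm (c, 0)).1, 0)).1) :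
    ∃ K : Submodule R A, Nonempty ((C × K) ≃ₗ[R] A) ∧ Nonempty ((K × B) ≃ₗ[R] Q) := by
  -- As `φ ∘ j` is bijective, $A=j(C)\oplus\ker\varphi$; and $\ker\varphi\times B$ is a complement
  -- of $e^{-1}(C)$, hence isomorphic to $Q$.
  let φ : A →ₗ[R] C := .fst R C Q ∘ₗ e.toLinearMap ∘ₗ .inl R A B
  let j : C →ₗ[R] A := .fst R A B ∘ₗ e.symm.toLinearMap ∘ₗ .inl R C Q
  have hφ : ∀ a b, (e (a, b)).1 = φ a + (e (0, b)).1 := fun a b => by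
    simp [φ, ← Prod.fst_add, ← map_add]
  let g : C ≃ₗ[R] C := .ofBijective (φ ∘ₗ j) h
  have hg : ∀ c, φ (j (g.symm c)) = c := fun c => g.apply_symm_apply c
  refine ⟨LinearMap.ker φ, ⟨.ofBijective ((j ∘ₗ g.symm.toLinearMap).coprod
    (LinearMap.ker φ).subtype) ⟨?_, ?_⟩⟩, ⟨.ofBijective (.snd R C Q ∘ₗ e.toLinearMap ∘ₗ
      (LinearMap.ker φ).subtype.prodMap .id) ⟨?_, ?_⟩⟩⟩
  · rw [← LinearMap.ker_eq_bot, LinearMap.ker_eq_bot']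
    rintro ⟨c, k, hk⟩ h0
    have h1 : j (g.symm c) + k = 0 := h0
    have h2 := congrArg φ h1
    rw [map_add, hg, LinearMap.mem_ker.1 hk, add_zero, map_zero] at h2
    subst h2
    simpa using h1
  · intro a
    refine ⟨(φ a, ⟨a - j (g.symm (φ a)), ?_⟩), ?_⟩
    · rw [LinearMap.mem_ker, map_sub, hg, sub_self]
    · simp
  · rw [← LinearMap.ker_eq_bot, LinearMap.ker_eq_bot']
    rintro ⟨⟨a, ha⟩, b⟩ h0
    have h1 : (e (a, b)).2 = 0 := h0
    have h2 : (a, b) = e.symm ((e (a, b)).1, 0) := by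
      rw [e.eq_symm_apply]
      exact Prod.ext rfl h1
    have h3 : a = j (e (a, b)).1 := congrArg Prod.fst h2
    have h4 : g (e (a, b)).1 = 0 := by
      change φ (j _) = 0
      rw [← h3]
      exact ha
    rw [LinearEquiv.map_eq_zero_iff] at h4
    rw [h4, Prod.mk_zero_zero, map_zero] at h2
    simpa using h2
  · intro q
    let p := e.symm (0, q)
    -- Adding `e.symm (c, 0)` moves the $A$-component of `p` into $\ker\varphi$ and leaves the
    -- $Q$-component `q` unchanged.
    let c := g.symm (-φ p.1)
    have hp : e p = (0, q) := e.apply_symm_apply _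
    let p' := p + e.symm (c, 0)
    have h1 : e p' = (c, q) := by simp [p', hp]
    refine ⟨(⟨p'.1, ?_⟩, p'.2), ?_⟩
    · rw [LinearMap.mem_ker]
      change φ (p.1 + j c) = 0
      rw [map_add, hg, add_neg_cancel]
    · exact congrArg Prod.snd h1

variable {R : Type u} [CommRing R]

theorem bijective_quotient_of_isUnit {J : Ideal R} {r : R} (hr : IsUnit r)
    {f : R ⧸ J →ₗ[R] R ⧸ J} (hf : f 1 = Ideal.Quotient.mk J r) : Function.Bijective f := by
  have h1 : ∀ x, f x = r • x := by
    intro x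
    obtain ⟨a, rfl⟩ := Ideal.Quotient.mk_surjective x
    have h2 : (Ideal.Quotient.mk J a : R ⧸ J) = a • (1 : R ⧸ J) := by
      rw [Algebra.smul_def, mul_one]; rfl
    rw [h2, map_smul, hf, smul_comm]
    congr 1
    rw [Algebra.smul_def, mul_one]; rfl
  obtain ⟨s, rfl⟩ := hr
  convert! MulAction.bijective s using 1
  exact funext h1

/-- Over a local ring, a direct summand of a direct sum of cyclic modules is again one. -/
theorem exists_equiv_pi_quotient_of_prod_equiv [IsLocalRing R] (m : ℕ) :
    ∀ (J : Fin m → Ideal R) (A B : Type u) [AddCommGroup A] [Module R A] [AddCommGroup B]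
      [Module R B], ((A × B) ≃ₗ[R] ∀ i, R ⧸ J i) →
      ∃ m' ≤ m, ∃ J' : Fin m' → Ideal R, Nonempty ((∀ i, R ⧸ J' i) ≃ₗ[R] A) := by
  induction m with
  | zero =>
    intro J A B _ _ _ _ e
    have : Subsingleton A :=
      have : Subsingleton (A × B) := e.toEquiv.subsingleton
      (LinearMap.inl_injective (R := R) (M := A) (M₂ := B)).subsingleton
    exact ⟨0, le_rfl, J, ⟨0⟩⟩
  | succ m ih =>
    intro J A B _ _ _ _ e
    let e' : (A × B) ≃ₗ[R] (R ⧸ J 0) × ∀ i : Fin m, R ⧸ J i.succ :=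
      e.trans (Fin.consLinearEquiv R fun i => R ⧸ J i).symm
    -- `f` and `f'` are the endomorphisms of the first summand that factor through $A$ and through
    -- $B$. They add up to the identity, so by locality one of them is bijective.
    let f : R ⧸ J 0 →ₗ[R] R ⧸ J 0 := .fst R _ _ ∘ₗ e'.toLinearMap ∘ₗ .inl R A B ∘ₗ .fst R A B ∘ₗ
      e'.symm.toLinearMap ∘ₗ .inl R _ _
    let f' : R ⧸ J 0 →ₗ[R] R ⧸ J 0 := .fst R _ _ ∘ₗ e'.toLinearMap ∘ₗ .inr R A B ∘ₗ .snd R A B ∘ₗ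
      e'.symm.toLinearMap ∘ₗ .inl R _ _
    have hadd : ∀ c, f c + f' c = c := by
      intro c
      have h1 : (((e'.symm (c, 0)).1, 0) : A × B) + (0, (e'.symm (c, 0)).2) = e'.symm (c, 0) := by
        simp
      have h2 := congrArg (fun p => (e' p).1) h1
      simp only [map_add, Prod.fst_add, LinearEquiv.apply_symm_apply] at h2
      exact h2
    obtain ⟨r, hr⟩ := Ideal.Quotient.mk_surjective (f 1)
    obtain ⟨s, hs⟩ := Ideal.Quotient.mk_surjective (f' 1)
    have hbij : Function.Bijective f ∨ Function.Bijective f' := by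
      by_cases htop : J 0 = ⊤
      · have : Subsingleton (R ⧸ J 0) := Ideal.Quotient.subsingleton_iff.2 htop
        exact .inl ⟨Function.injective_of_subsingleton _, Function.surjective_to_subsingleton _⟩
      · have h3 : r + s - 1 ∈ J 0 := by
          rw [← Ideal.Quotient.eq, map_add, hr, hs, hadd, map_one]
        have h4 : ¬ (r ∈ maximalIdeal R ∧ s ∈ maximalIdeal R) := by
          rintro ⟨h5, h6⟩
          have h7 := sub_mem (add_mem h5 h6) (le_maximalIdeal htop h3)
          rw [sub_sub_cancel] at h7
          exact (mem_maximalIdeal _).1 h7 isUnit_one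
        simp only [mem_maximalIdeal, mem_nonunits_iff, not_and_or, not_not] at h4
        exact h4.imp (fun h => bijective_quotient_of_isUnit h hr.symm)
          (fun h => bijective_quotient_of_isUnit h hs.symm)
    -- In the first case $R/J_0$ splits off $A$ and is put back after the induction; in the second
    -- it splits off $B$, and $A$ stays whole.
    rcases hbij with hbij | hbij
    · obtain ⟨K, ⟨e₁⟩, ⟨e₂⟩⟩ := exists_equiv_of_bijective_comp e' hbij
      obtain ⟨m', hm', J', ⟨e₃⟩⟩ := ih _ _ _ e₂
      exact ⟨m' + 1, by lia, Fin.cons (J 0) J', ⟨(Fin.consLinearEquiv R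
        fun i => R ⧸ (Fin.cons (J 0) J' : Fin (m' + 1) → Ideal R) i).symm.trans
          (((LinearEquiv.refl R _).prodCongr e₃).trans e₁)⟩⟩
    · obtain ⟨K, -, ⟨e₂⟩⟩ :=
        exists_equiv_of_bijective_comp ((LinearEquiv.prodComm R B A).trans e') hbij
      obtain ⟨m', hm', J', e₃⟩ := ih _ _ _ ((LinearEquiv.prodComm R A K).trans e₂)
      exact ⟨m', by lia, J', e₃⟩

theorem CyclicIndep.exists_equiv_pi_quotient {P : Type*} [AddCommGroup P] [Module R P] {m : ℕ}
    {v : Fin m → P} (hv : CyclicIndep R v) (ht : span R (Set.range v) = ⊤) :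
    ∃ J : Fin m → Ideal R, Nonempty (P ≃ₗ[R] ∀ i, R ⧸ J i) := by
  let f := Fintype.linearCombination R v
  have hker : LinearMap.ker f = Submodule.pi Set.univ fun i => Ideal.torsionOf R P (v i) := by
    ext c
    simp only [LinearMap.mem_ker, f, Fintype.linearCombination_apply, Submodule.mem_pi,
      Set.mem_univ, true_imp_iff, Ideal.mem_torsionOf_iff]
    exact ⟨cyclicIndep_iff_fintype.1 hv c, fun h => Finset.sum_eq_zero fun i _ => h i⟩
  have hsurj : Function.Surjective f := by
    rw [← LinearMap.range_eq_top, Fintype.range_linearCombination, ht]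
  exact ⟨_, ⟨(f.quotKerEquivOfSurjective hsurj).symm.trans
    ((Submodule.quotEquivOfEq _ _ hker).trans (Submodule.quotientPi _))⟩⟩

theorem IsDirectSumOfAtMostCyclics.of_equiv_pi_quotient {A : Type*} [AddCommGroup A] [Module R A]
    {m : ℕ} {J : Fin m → Ideal R} (e : (∀ i, R ⧸ J i) ≃ₗ[R] A) :
    IsDirectSumOfAtMostCyclics R m A := by
  classical
  let w : Fin m → ∀ i, R ⧸ J i := fun i => Pi.single i 1
  have hsum : ∀ c : Fin m → R, ∑ i, c i • w i = fun i => Ideal.Quotient.mk (J i) (c i) := by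
    intro c
    ext i
    rw [Finset.sum_apply, Finset.sum_eq_single i]
    · simp [w, Algebra.smul_def]
    · intro j _ hj
      simp [w, Pi.single_eq_of_ne hj.symm]
    · simp
  have hw : CyclicIndep R w := by
    rw [cyclicIndep_iff_fintype]
    intro c hc i
    rw [hsum] at hc
    ext j
    obtain rfl | hij := eq_or_ne j i
    · simpa [w, Algebra.smul_def] using congrFun hc j
    · simp [w, hij]
  refine .of_cyclicIndep (v := e ∘ w) (by simp) (hw.map (f := e.toLinearMap) e.injective) ?_
  rw [eq_top_iff]
  intro a _
  choose c hc using fun i => Ideal.Quotient.mk_surjective (e.symm a i)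
  refine (mem_span_range_iff_exists_fun R).2 ⟨c, ?_⟩
  rw [← e.symm.injective.eq_iff]
  simpa [hsum] using funext hc

theorem IsDirectSumOfAtMostCyclics.mono {A : Type*} [AddCommGroup A] [Module R A] {m n : ℕ}
    (h : IsDirectSumOfAtMostCyclics R m A) (hmn : m ≤ n) : IsDirectSumOfAtMostCyclics R n A := by
  obtain ⟨k, hk, N, hN⟩ := h
  exact ⟨k, hk.trans hmn, N, hN⟩

theorem IsSummandOfAtMostCyclics.isDirectSumOfAtMostCyclics [IsLocalRing R] {M : Type u}
    [AddCommGroup M] [Module R M] {n : ℕ} (h : IsSummandOfAtMostCyclics R n M) :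
    IsDirectSumOfAtMostCyclics R n M := by
  obtain ⟨P, _, _, hP, S, T, hST, ⟨e⟩⟩ := h
  obtain ⟨m, hm, v, hv, ht⟩ := hP.exists_cyclicIndep
  obtain ⟨J, ⟨e₁⟩⟩ := hv.exists_equiv_pi_quotient ht
  obtain ⟨m', hm', J', ⟨e₂⟩⟩ := exists_equiv_pi_quotient_of_prod_equiv m J S T
    ((Submodule.prodEquivOfIsCompl S T hST).trans e₁)
  exact (IsDirectSumOfAtMostCyclics.of_equiv_pi_quotient (e₂.trans e.symm)).mono (hm'.trans hm)

end KrullSchmidt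

/-! ### Annihilator quotients and mixed products -/

section Quotient

variable {R : Type*} [CommRing R]

/-- The ring `R ⧸ Ann(x)` is a principal ideal ring iff all submodules of `R x` are cyclic. -/
theorem isPrincipalIdealRing_quotient_torsionOf_iff {x : R} :
    IsPrincipalIdealRing (R ⧸ Ideal.torsionOf R R x) ↔
      ∀ J : Ideal R, J ≤ Ideal.span {x} → J.IsPrincipal := by
  have hsub : ∀ a b : R, Ideal.Quotient.mk (Ideal.torsionOf R R x) a = Ideal.Quotient.mk _ b ↔
      a * x = b * x := fun a b => by
    rw [Ideal.Quotient.eq, Ideal.mem_torsionOf_iff, smul_eq_mul, sub_mul, sub_eq_zero]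
  constructor
  · intro h J hJ
    let K : Ideal R := Submodule.comap (LinearMap.toSpanSingleton R R x) J
    obtain ⟨g, hg⟩ := (h.principal (K.map (Ideal.Quotient.mk _))).principal
    obtain ⟨g, rfl⟩ := Ideal.Quotient.mk_surjective g
    have hgK : g * x ∈ J := by
      obtain ⟨k, hk, hkg⟩ := (Ideal.mem_map_iff_of_surjective _ Ideal.Quotient.mk_surjective).1
        (hg ▸ mem_span_singleton_self _)
      rw [← (hsub k g).1 hkg]
      exact hk
    refine ⟨g * x, le_antisymm (fun y hy => ?_) (span_le.2 (by simpa using hgK))⟩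
    obtain ⟨a, rfl⟩ := Ideal.mem_span_singleton'.1 (hJ hy)
    have ha : Ideal.Quotient.mk (Ideal.torsionOf R R x) a ∈ K.map (Ideal.Quotient.mk _) :=
      Ideal.mem_map_of_mem _ hy
    rw [hg, mem_span_singleton] at ha
    obtain ⟨b, hb⟩ := ha
    obtain ⟨b, rfl⟩ := Ideal.Quotient.mk_surjective b
    rw [smul_eq_mul, ← map_mul, hsub] at hb
    exact mem_span_singleton.2 ⟨b, by rw [← hb, smul_eq_mul, mul_assoc]⟩
  · intro h
    refine ⟨fun K => ?_⟩
    let K' : Ideal R := K.comap (Ideal.Quotient.mk _)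
    obtain ⟨g, hg⟩ := (h (Submodule.map (LinearMap.toSpanSingleton R R x) K') (by
      rintro _ ⟨a, -, rfl⟩
      exact Ideal.mem_span_singleton'.2 ⟨a, rfl⟩)).principal
    obtain ⟨a, ha, hag⟩ : g ∈ Submodule.map (LinearMap.toSpanSingleton R R x) K' :=
      hg ▸ mem_span_singleton_self _
    refine ⟨Ideal.Quotient.mk _ a, le_antisymm (fun y hy => ?_) (span_le.2 (by simpa using! ha))⟩
    obtain ⟨b, rfl⟩ := Ideal.Quotient.mk_surjective y
    have hb : b * x ∈ Submodule.map (LinearMap.toSpanSingleton R R x) K' := ⟨b, hy, rfl⟩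
    rw [hg, mem_span_singleton, ← hag] at hb
    obtain ⟨c, hc⟩ := hb
    refine mem_span_singleton.2 ⟨Ideal.Quotient.mk _ c, ?_⟩
    rw [smul_eq_mul, ← map_mul, hsub, mul_assoc]
    exact hc

theorem CyclicIndep.smul_eq_zero_of_smul_eq {M : Type*} [AddCommGroup M] [Module R M] {ι : Type*}
    {v : ι → M} (hv : CyclicIndep R v) {i j : ι} (hij : i ≠ j) {a b : R}
    (h : a • v i = b • v j) : a • v i = 0 := by
  simpa [Finsupp.single_apply, hij.symm] using
    hv (Finsupp.single i a - Finsupp.single j b) (by simp [h]) i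

/-- The product lies in both $Rv_i$ and $Rv_j$. -/
theorem CyclicIndep.mul_eq_zero {ι : Type*} {v : ι → R} (hv : CyclicIndep R v) {i j : ι}
    (hij : i ≠ j) : v i * v j = 0 := by
  rw [mul_comm]
  exact hv.smul_eq_zero_of_smul_eq hij (mul_comm _ _)

end Quotient

/-! ### From ideals to the structure of the maximal ideal -/

section Local

variable {R : Type*} [CommRing R] [IsLocalRing R]

theorem isUnit_of_notMem_maximalIdeal {a : R} (h : a ∉ maximalIdeal R) : IsUnit a := by
  simpa using h

theorem one_sub_notMem {a : R} (h : a ∈ maximalIdeal R) : 1 - a ∉ maximalIdeal R := fun h' => by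
  have := add_mem h h'
  rw [add_sub_cancel] at this
  exact (mem_maximalIdeal _).1 this isUnit_one

/-- Nakayama for one generator: $Rmx=Rx$ with $m\in\mathcal M$ gives $(1-rm)x=0$, hence $x=0$. -/
theorem isSimpleModule_span_singleton_iff {x : R} :
    IsSimpleModule R (Ideal.span {x}) ↔ x ≠ 0 ∧ ∀ m ∈ maximalIdeal R, m * x = 0 := by
  rw [isSimpleModule_iff_isAtom]
  constructor
  · rintro ⟨h0, h⟩
    refine ⟨fun hx => h0 (by simp [hx]), fun m hm => ?_⟩
    by_contra hmx
    have hlt : Ideal.span {m * x} < Ideal.span {x} := by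
      refine lt_of_le_of_ne (Ideal.span_singleton_le_span_singleton.2 (dvd_mul_left _ _)) ?_
      intro heq
      obtain ⟨r, hr⟩ := Ideal.mem_span_singleton'.1 (heq ▸ Ideal.mem_span_singleton_self x)
      have h1 : (1 - r * m) • x = 0 := by
        rw [smul_eq_mul]; linear_combination -hr
      exact one_sub_notMem (Ideal.mul_mem_left _ r hm)
        (mem_maximalIdeal_of_smul_eq_zero (fun hx => hmx (by simp [hx])) h1)
    have := h _ hlt
    rw [Ideal.span_singleton_eq_bot] at this
    exact hmx this
  · rintro ⟨h0, h⟩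
    refine ⟨fun h' => h0 (by simpa using h'), fun J hJ => ?_⟩
    by_contra hne
    obtain ⟨y, hy, hy0⟩ := Submodule.exists_mem_ne_zero_of_ne_bot hne
    obtain ⟨r, rfl⟩ := Ideal.mem_span_singleton'.1 (hJ.le hy)
    have hr : IsUnit r := isUnit_of_notMem_maximalIdeal fun hr => hy0 (h r hr)
    refine hJ.not_ge ((Ideal.span_singleton_le_iff_mem _).2 ?_)
    exact (Ideal.unit_mul_mem_iff_mem J hr).1 hy

/-- Three elements with zero mixed products and nonzero squares cannot exist when all ideals are
direct sums of cyclic modules. -/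
theorem false_of_three_mul_self_ne_zero (H : ∀ I : Ideal R, IsDirectSumOfCyclics R I) {x y z : R}
    (hxy : x * y = 0) (hxz : x * z = 0) (hyz : y * z = 0) (hx : x * x ≠ 0) (hy : y * y ≠ 0)
    (hz : z * z ≠ 0) : False := by
  obtain ⟨ι, w, -, hw, hspan⟩ :=
    (H (Ideal.span {x + y, x + z})).exists_submodule_cyclicIndep
  have h1 : ∀ i, ∃ a b, a * (x + y) + b * (x + z) = w i := fun i =>
    Ideal.mem_span_pair.1 (hspan ▸ subset_span ⟨i, rfl⟩)
  choose α β hαβ using h1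
  have hxw : ∀ i, x * w i = (α i + β i) * (x * x) := fun i => by
    rw [← hαβ]; linear_combination α i * hxy + β i * hxz
  have hyw : ∀ i, y * w i = α i * (y * y) := fun i => by
    rw [← hαβ]; linear_combination (α i + β i) * hxy + β i * hyz
  have hzw : ∀ i, z * w i = β i * (z * z) := fun i => by
    rw [← hαβ]; linear_combination (α i + β i) * hxz + α i * hyz
  have hprime := (maximalIdeal.isMaximal R).isPrime
  -- Applied to $t=x,y,z$ with $\gamma=\alpha+\beta,\alpha,\beta$: at most one $\gamma_i$ is a unit,
  -- since $\gamma_j t w_i=\gamma_i t w_j$ lies in two independent summands and so vanishes.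
  have pair : ∀ (t : R) (γ : ι → R), t * t ≠ 0 → (∀ i, t * w i = γ i * (t * t)) →
      ∀ i j, i ≠ j → γ i ∉ maximalIdeal R → γ j ∈ maximalIdeal R := by
    intro t γ ht hγ i j hij hi
    have h2 : (γ j * t) • w i = (γ i * t) • w j := by
      simp only [smul_eq_mul]
      linear_combination γ j * hγ i - γ i * hγ j
    have h3 := hw.smul_eq_zero_of_smul_eq hij h2
    rw [smul_eq_mul, mul_assoc, hγ, ← mul_assoc] at h3
    exact (hprime.mem_or_mem (mem_maximalIdeal_of_smul_eq_zero ht h3)).resolve_right hi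
  obtain ⟨r, hr⟩ := Finsupp.mem_span_range_iff_exists_finsupp.1
    (hspan ▸ subset_span (by simp) : x + y ∈ span R (Set.range w))
  obtain ⟨s, hs⟩ := Finsupp.mem_span_range_iff_exists_finsupp.1
    (hspan ▸ subset_span (by simp) : x + z ∈ span R (Set.range w))
  have mulsum : ∀ (t : R) (γ : ι → R) (c : ι →₀ R), (∀ i, t * w i = γ i * (t * t)) →
      t * (c.sum fun i a => a • w i) = (∑ i ∈ c.support, c i * γ i) * (t * t) := by
    intro t γ c hγ
    rw [Finsupp.sum, Finset.mul_sum, Finset.sum_mul]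
    refine Finset.sum_congr rfl fun i _ => ?_
    rw [smul_eq_mul]
    linear_combination c i * hγ i
  -- Multiplying $x+y=\sum r_iw_i$ and $x+z=\sum s_iw_i$ by $y$ or $z$ gives, modulo $\mathcal M$:
  -- $\sum r_i\alpha_i\equiv1$, $\sum r_i\beta_i\equiv0$, $\sum s_i\beta_i\equiv1$.
  have hry : 1 - ∑ i ∈ r.support, r i * α i ∈ maximalIdeal R := by
    refine mem_maximalIdeal_of_smul_eq_zero hy ?_
    have := mulsum y α r hyw
    rw [hr] at this
    rw [smul_eq_mul]; linear_combination this - hxy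
  have hrz : ∑ i ∈ r.support, r i * β i ∈ maximalIdeal R := by
    refine mem_maximalIdeal_of_smul_eq_zero hz ?_
    have := mulsum z β r hzw
    rw [hr] at this
    rw [smul_eq_mul]; linear_combination - this + hyz + hxz
  have hsz : 1 - ∑ i ∈ s.support, s i * β i ∈ maximalIdeal R := by
    refine mem_maximalIdeal_of_smul_eq_zero hz ?_
    have := mulsum z β s hzw
    rw [hs] at this
    rw [smul_eq_mul]; linear_combination this - hxz
  obtain ⟨i, hi, hri⟩ : ∃ i ∈ r.support, r i * α i ∉ maximalIdeal R := by
    by_contra! hcon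
    exact one_sub_notMem (sum_mem hcon) hry
  have hri0 : r i ∉ maximalIdeal R := fun h => hri (Ideal.mul_mem_right _ _ h)
  have hαi : α i ∉ maximalIdeal R := fun h => hri (Ideal.mul_mem_left _ _ h)
  -- If $\beta_i\in\mathcal M$, then $\alpha_i$ and $\alpha_i+\beta_i$ are the only units of their
  -- kinds, so all $\beta_j\in\mathcal M$, against `hsz`. If $\beta_i$ is a unit, it is the only
  -- one, and $r_i\beta_i$ is a unit, against `hrz`.
  by_cases hβi : β i ∈ maximalIdeal R
  · have hall : ∀ j, β j ∈ maximalIdeal R := by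
      intro j
      obtain rfl | hij := eq_or_ne i j
      · exact hβi
      · have h4 := pair x (fun i => α i + β i) hx hxw i j hij
          fun h => hαi ((add_mem_cancel_right hβi).1 h)
        exact (add_mem_cancel_left (pair y α hy hyw i j hij hαi)).1 h4
    exact one_sub_notMem (sum_mem fun j _ => Ideal.mul_mem_left _ _ (hall j)) hsz
  · classical
    rw [← Finset.add_sum_erase _ _ hi] at hrz
    have h5 := (add_mem_cancel_right (sum_mem fun j hj => Ideal.mul_mem_left _ _
      (pair z β hz hzw i j (Finset.ne_of_mem_erase hj).symm hβi))).1 hrz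
    exact (hprime.mem_or_mem h5).elim hri0 hβi

/-- If `𝔪 = R x + Ann(x)` and all ideals are direct sums of cyclic modules, then all submodules of
`R x` are cyclic. -/
theorem isPrincipal_of_le_span_singleton (H : ∀ I : Ideal R, IsDirectSumOfCyclics R I) {x : R}
    (hxm : x ∈ maximalIdeal R) (hm : ∀ m ∈ maximalIdeal R, ∃ c, m * x = c * x * x) (J : Ideal R)
    (hJ : J ≤ Ideal.span {x}) : J.IsPrincipal := by
  let N : Ideal R := ⨅ i : ℕ, Ideal.span {x ^ (i + 1)}
  have hN : ∀ y, y ∈ N ↔ ∀ i : ℕ, y ∈ Ideal.span {x ^ (i + 1)} := fun y => by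
    simp only [N, mem_iInf]
  -- Stop at the last power of $x$ whose ideal contains $y$: a coefficient in $\mathcal M$ would
  -- allow one more factor $x$ by `hm`.
  have hU : ∀ y ∈ Ideal.span {x}, y ∉ N → ∃ (u : R) (i : ℕ), IsUnit u ∧ y = u * x ^ (i + 1) := by
    intro y hy hyN
    rw [hN, not_forall] at hyN
    classical
    have hspec := Nat.find_spec hyN
    rcases hj : Nat.find hyN with _ | j
    · rw [hj, zero_add, pow_one] at hspec
      exact absurd hy hspec
    · have hmem := not_not.1 (Nat.find_min hyN (m := j) (by lia))
      obtain ⟨c, hc⟩ := Ideal.mem_span_singleton'.1 hmem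
      refine ⟨c, j, isUnit_of_notMem_maximalIdeal fun hcm => hspec ?_, hc.symm⟩
      obtain ⟨d, hd⟩ := hm c hcm
      rw [hj, Ideal.mem_span_singleton']
      exact ⟨d, by rw [← hc]; linear_combination (-x ^ j) * hd⟩
  -- This is $N=xN$. Write $w=cx^2$; if $cx\notin N$, then $w$ is a unit times $x^{j+2}$ and also
  -- lies in $Rx^{j+3}$, which forces $w=0$.
  have hstep : ∀ w ∈ N, ∃ w' ∈ N, w = x * w' := by
    intro w hw
    obtain ⟨c, hc⟩ := Ideal.mem_span_singleton'.1 ((hN w).1 hw 1)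
    by_cases hcN : c * x ∈ N
    · exact ⟨c * x, hcN, by rw [← hc]; ring⟩
    · obtain ⟨u, j, hu, huj⟩ := hU _ (Ideal.mem_span_singleton'.2 ⟨c, rfl⟩) hcN
      obtain ⟨d, hd⟩ := Ideal.mem_span_singleton'.1 ((hN w).1 hw (j + 2))
      refine ⟨0, zero_mem _, ?_⟩
      rw [mul_zero]
      by_contra hw0
      have h1 : w = u * x ^ (j + 2) := by rw [← hc]; linear_combination x * huj
      have h2 : (u - d * x) • x ^ (j + 2) = 0 := by
        rw [smul_eq_mul]; linear_combination -hd - h1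
      have h3 := mem_maximalIdeal_of_smul_eq_zero (fun h => hw0 (by rw [h1, h, mul_zero])) h2
      have h4 := add_mem h3 (Ideal.mul_mem_left _ d hxm)
      rw [sub_add_cancel] at h4
      exact (mem_maximalIdeal _).1 h4 hu
  -- $N$ is not known to be finitely generated, so Nakayama is applied to a single summand: $N=xN$
  -- and independence give $(1-xc_i)w_i=0$.
  have hN0 : N = ⊥ := by
    obtain ⟨ι, w, hw0, hw, hspan⟩ := (H N).exists_submodule_cyclicIndep
    rcases isEmpty_or_nonempty ι with hι | ⟨⟨i⟩⟩
    · rw [← hspan, Set.range_eq_empty, span_empty]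
    · obtain ⟨w', hw', hww⟩ := hstep (w i) (hspan ▸ subset_span ⟨i, rfl⟩)
      rw [← hspan] at hw'
      obtain ⟨c, hc⟩ := Finsupp.mem_span_range_iff_exists_finsupp.1 hw'
      have h1 := hw (Finsupp.single i 1 - x • c) (by
        rw [map_sub, map_smul, Finsupp.linearCombination_apply R c, hc]
        simp [hww]) i
      simp only [Finsupp.coe_sub, Finsupp.coe_smul, Pi.sub_apply, Pi.smul_apply,
        Finsupp.single_eq_same] at h1
      exact absurd (mem_maximalIdeal_of_smul_eq_zero (hw0 i) h1)
        (one_sub_notMem (Ideal.mul_mem_right _ _ hxm))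
  have hpow : ∀ y ∈ J, y ≠ 0 → ∃ i : ℕ, x ^ (i + 1) ∈ J ∧ y ∈ Ideal.span {x ^ (i + 1)} := by
    intro y hy hy0
    obtain ⟨u, i, hu, rfl⟩ := hU y (hJ hy) (by simpa [hN0] using hy0)
    exact ⟨i, (Ideal.unit_mul_mem_iff_mem J hu).1 hy, Ideal.mem_span_singleton'.2 ⟨u, rfl⟩⟩
  by_cases hJ0 : J = ⊥
  · rw [hJ0]; infer_instance
  obtain ⟨y, hy, hy0⟩ := Submodule.exists_mem_ne_zero_of_ne_bot hJ0
  have hex : ∃ i : ℕ, x ^ (i + 1) ∈ J := let ⟨i, hi, _⟩ := hpow y hy hy0; ⟨i, hi⟩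
  classical
  refine ⟨x ^ (Nat.find hex + 1), le_antisymm (fun z hz => ?_)
    ((Ideal.span_singleton_le_iff_mem _).2 (Nat.find_spec hex))⟩
  by_cases hz0 : z = 0
  · rw [hz0]; exact zero_mem _
  obtain ⟨i, hi, hzi⟩ := hpow z hz hz0
  exact (Ideal.span_singleton_le_span_singleton.2
    (pow_dvd_pow x (Nat.add_le_add_right (Nat.find_min' hex hi) 1))) hzi

/-- The bound is `max n 1` because $\mathcal M=0$ is written with one zero summand, to keep $k$
positive. -/
theorem maximalIdealDecomposes_of_isDirectSumOfCyclics
    (H : ∀ I : Ideal R, IsDirectSumOfCyclics R I) {n : ℕ} {w : Fin n → R}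
    (hw : span R (Set.range w) = maximalIdeal R) :
    ∃ k, 0 < k ∧ k ≤ max n 1 ∧ MaximalIdealDecomposes R k := by
  obtain ⟨ι, v, hv0, hv, hspan⟩ := (H (maximalIdeal R)).exists_submodule_cyclicIndep
  obtain ⟨hfin, hcard⟩ := hv.finite_card_le hv0 (hspan.trans hw.symm)
  have hmem : ∀ i, v i ∈ maximalIdeal R := fun i => hspan ▸ subset_span ⟨i, rfl⟩
  have hmul : ∀ i, ∀ m ∈ maximalIdeal R, ∃ c, m * v i = c * v i * v i := by
    intro i m hm
    obtain ⟨c, rfl⟩ := Finsupp.mem_span_range_iff_exists_finsupp.1 (hspan.symm ▸ hm)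
    refine ⟨c i, ?_⟩
    rw [Finsupp.sum, Finset.sum_mul]
    refine Finset.sum_eq_single i (fun j _ hj => ?_) fun hi => ?_
    · rw [smul_eq_mul, mul_assoc, hv.mul_eq_zero hj, mul_zero]
    · rw [Finsupp.notMem_support_iff.1 hi, zero_smul, zero_mul]
  rcases isEmpty_or_nonempty ι with hι | hι
  · refine ⟨1, one_pos, le_max_right _ _, fun _ => 0, ⟨isDirectSumOf_span_singleton_iff.2
      ⟨fun c _ i => smul_zero _, ?_⟩, ?_⟩, fun i => ?_⟩
    · rw [← hspan, Set.range_eq_empty v]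
      simp
    · exact (Set.ncard_le_card _).trans (by simp)
    · rw [isPrincipalIdealRing_quotient_torsionOf_iff]
      intro J hJ
      rw [Ideal.span_singleton_eq_bot.2 rfl, le_bot_iff] at hJ
      rw [hJ]; infer_instance
  · let e := (Finite.equivFin ι).symm
    refine ⟨Nat.card ι, Nat.card_pos, hcard.trans (le_max_left _ _), v ∘ e,
      ⟨isDirectSumOf_span_singleton_iff.2 ⟨hv.comp e.injective, ?_⟩, ?_⟩, fun i => ?_⟩
    · rw [Set.range_comp, e.range_eq_univ, Set.image_univ, hspan]
    · by_contra! hcon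
      obtain ⟨i, hi, j, hj, l, hl, hij, hil, hjl⟩ := (Set.two_lt_ncard (Set.toFinite _)).1 hcon
      -- If $v_i^2=0$ then $\mathcal M v_i=Rv_i^2=0$, so $Rv_i$ would be simple.
      have hsq : ∀ i, ¬ IsSimpleModule R (Ideal.span {(v ∘ e) i}) →
          v (e i) * v (e i) ≠ 0 := by
        intro i hi h0
        refine hi (isSimpleModule_span_singleton_iff.2 ⟨hv0 _, fun m hm => ?_⟩)
        obtain ⟨c, hc⟩ := hmul (e i) m hm
        simp only [Function.comp_apply]
        rw [hc, mul_assoc, h0, mul_zero]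
      exact false_of_three_mul_self_ne_zero H (hv.mul_eq_zero (e.injective.ne hij))
        (hv.mul_eq_zero (e.injective.ne hil)) (hv.mul_eq_zero (e.injective.ne hjl))
        (hsq i hi) (hsq j hj) (hsq l hl)
    · rw [isPrincipalIdealRing_quotient_torsionOf_iff]
      exact isPrincipal_of_le_span_singleton H (hmem _) (hmul _)

end Local

/-! ### Decomposing every ideal from the maximal ideal -/

section Decomposition

variable {R : Type*} [CommRing R]

theorem isDecomposition_fin_one (g : R) :
    IsDecomposition (Ideal.span {g}) fun _ : Fin 1 => g := by
  refine ⟨isDirectSumOf_span_singleton_iff.2 ⟨cyclicIndep_iff_fintype.2 fun c hc i => ?_, ?_⟩,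
    (Set.ncard_le_card _).trans (by simp)⟩
  · rw [Subsingleton.elim i 0]
    simpa using hc
  · rw [Set.range_const]

theorem IsDecomposition.comp_equiv {I : Ideal R} {m : ℕ} {v : Fin m → R} (h : IsDecomposition I v)
    (e : Equiv.Perm (Fin m)) : IsDecomposition I (v ∘ e) := by
  obtain ⟨h1, h2⟩ := h
  rw [isDirectSumOf_span_singleton_iff] at h1
  refine ⟨isDirectSumOf_span_singleton_iff.2 ⟨h1.1.comp e.injective, ?_⟩, ?_⟩
  · rw [Set.range_comp, e.range_eq_univ, Set.image_univ, h1.2]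
  · refine le_trans (Set.ncard_le_ncard_of_injOn e (fun i hi => hi) e.injective.injOn) h2

/-- Used to move the summands that are not simple to positions 0 and 1. -/
theorem exists_perm_of_ncard_le_two {l : ℕ} {s : Set (Fin (l + 2))} (hs : s.ncard ≤ 2) :
    ∃ e : Equiv.Perm (Fin (l + 2)), ∀ i, e i ∈ s → i = 0 ∨ i = 1 := by
  obtain ⟨t, hst, ht⟩ := Finset.exists_superset_card_eq (s := s.toFinite.toFinset) (n := 2)
    (by rwa [← Set.ncard_eq_toFinset_card]) (by simp)
  obtain ⟨a, b, hab, rfl⟩ := Finset.card_eq_two.1 ht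
  let e : Equiv.Perm (Fin (l + 2)) := Equiv.swap 1 (Equiv.swap 0 a b) |>.trans (Equiv.swap 0 a)
  have h0 : e 0 = a := by
    have h1 : (0 : Fin (l + 2)) ≠ Equiv.swap 0 a b := by
      rw [ne_comm, Ne, Equiv.swap_apply_eq_iff, Equiv.swap_apply_left]
      exact hab.symm
    simp [e, Equiv.swap_apply_of_ne_of_ne (Fin.zero_ne_one) h1]
  have h1 : e 1 = b := by simp [e]
  refine ⟨e, fun i hi => ?_⟩
  have : e i ∈ ({a, b} : Finset (Fin (l + 2))) := hst (by simpa using hi)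
  simp only [Finset.mem_insert, Finset.mem_singleton] at this
  rw [← h0, ← h1] at this
  exact this.imp (fun h => e.injective h) (fun h => e.injective h)

variable [IsLocalRing R]

/-- An ideal killed by the maximal ideal and contained in an ideal with `l` generators is a direct
sum of at most `l` nonzero cyclic ideals. -/
theorem exists_cyclicIndep_of_mul_eq_zero {l : ℕ} {s : Fin l → R} {T : Ideal R}
    (hT : T ≤ span R (Set.range s)) (hs : ∀ m ∈ maximalIdeal R, ∀ i, m * s i = 0) :
    ∃ l' ≤ l, ∃ t : Fin l' → R, (∀ i, t i ≠ 0) ∧ CyclicIndep R t ∧ span R (Set.range t) = T := by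
  have hmT : ∀ m ∈ maximalIdeal R, ∀ g ∈ T, m * g = 0 := by
    intro m hm g hg
    obtain ⟨c, rfl⟩ := (mem_span_range_iff_exists_fun R).1 (hT hg)
    rw [Finset.mul_sum]
    exact Finset.sum_eq_zero fun i _ => by rw [smul_eq_mul, mul_left_comm, hs m hm, mul_zero]
  -- $T$ is in effect a vector space over the residue field; a longest independent family of nonzero
  -- elements spans it.
  let P : ℕ → Prop := fun l' =>
    ∃ t : Fin l' → R, (∀ i, t i ≠ 0) ∧ CyclicIndep R t ∧ ∀ i, t i ∈ T
  have hP : ∀ l', P l' → l' ≤ l := by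
    rintro l' ⟨t, ht0, ht, htT⟩
    choose A hA using fun j => (mem_span_range_iff_exists_fun R).1 (hT (htT j))
    let a : Fin l' → Fin l → ResidueField R := fun j i => residue R (A j i)
    have hli : LinearIndependent (ResidueField R) a := by
      rw [Fintype.linearIndependent_iff]
      intro c hc j
      choose d hd using fun j => residue_surjective (c j)
      have h1 : ∀ i, ∑ j, d j * A j i ∈ maximalIdeal R := by
        intro i
        rw [← residue_eq_zero_iff, map_sum]
        simpa [a, hd] using congrFun hc i
      have h2 : ∑ j, d j • t j = 0 := by
        simp only [← hA, smul_eq_mul, Finset.mul_sum]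
        rw [Finset.sum_comm]
        refine Finset.sum_eq_zero fun i _ => ?_
        rw [← hs _ (h1 i) i, Finset.sum_mul]
        exact Finset.sum_congr rfl fun j _ => (mul_assoc _ _ _).symm
      have h3 := mem_maximalIdeal_of_smul_eq_zero (ht0 j) (cyclicIndep_iff_fintype.1 ht d h2 j)
      rwa [← residue_eq_zero_iff, hd] at h3
    simpa using hli.fintype_card_le_finrank
  classical
  have hP0 : P 0 := ⟨Fin.elim0, fun i => i.elim0, fun c _ i => i.elim0, fun i => i.elim0⟩
  let q := Nat.findGreatest P l
  obtain ⟨t, ht0, ht, htT⟩ : P q := Nat.findGreatest_spec (Nat.zero_le l) hP0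
  refine ⟨q, Nat.findGreatest_le l, t, ht0, ht, le_antisymm (span_le.2 ?_) fun g hg => ?_⟩
  · rintro _ ⟨i, rfl⟩
    exact htT i
  · by_contra hgt
    have hsucc : P (q + 1) := by
      refine ⟨Fin.cons g t, fun i => ?_, cyclicIndep_iff_fintype.2 fun c hc => ?_, fun i => ?_⟩
      · refine Fin.cases ?_ (fun i => ?_) i
        · rintro rfl
          exact hgt (zero_mem _)
        · simpa using ht0 i
      · simp only [Fin.sum_univ_succ, Fin.cons_zero, Fin.cons_succ] at hc
        have hc0 : c 0 ∈ maximalIdeal R := by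
          by_contra hu
          refine hgt ((Ideal.unit_mul_mem_iff_mem _ (isUnit_of_notMem_maximalIdeal hu)).1 ?_)
          rw [← smul_eq_mul, eq_neg_of_add_eq_zero_left hc]
          exact neg_mem (sum_mem fun i _ => smul_mem _ _ (subset_span ⟨i, rfl⟩))
        have hcg : c 0 • g = 0 := hmT _ hc0 g hg
        rw [hcg, zero_add] at hc
        intro i
        refine Fin.cases ?_ (fun i => ?_) i
        · simpa using hcg
        · simpa using cyclicIndep_iff_fintype.1 ht _ hc i
      · refine Fin.cases ?_ (fun i => ?_) i
        · simpa using hg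
        · simpa using htT i
    exact absurd (Nat.le_findGreatest (hP _ hsucc) hsucc) (by simp [q])

/-- Let `𝔪 = R x ⊕ R y ⊕ S` with `𝔪 S = 0`, where all submodules of `R x` and of `R y` are
cyclic. Then every ideal `I ≤ 𝔪` has the form `R a ⊕ R b ⊕ (I ⊓ S)`. -/
theorem exists_decomposition_of_le_maximalIdeal {x y : R} {S I : Ideal R}
    (hM : ∀ m ∈ maximalIdeal R, ∃ a b, ∃ s ∈ S, m = a * x + b * y + s)
    (hind : ∀ a b, ∀ s ∈ S, a * x + b * y + s = 0 → a * x = 0 ∧ b * y = 0 ∧ s = 0)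
    (hS : ∀ m ∈ maximalIdeal R, ∀ s ∈ S, m * s = 0)
    (hym : y ∈ maximalIdeal R)
    (hx : ∀ J : Ideal R, J ≤ Ideal.span {x} → J.IsPrincipal)
    (hy : ∀ J : Ideal R, J ≤ Ideal.span {y} → J.IsPrincipal) (hI : I ≤ maximalIdeal R) :
    ∃ a ∈ I, ∃ b ∈ I, (∀ g ∈ I, ∃ α β, ∃ t ∈ I ⊓ S, g = α * a + β * b + t) ∧
      ∀ α β, ∀ t ∈ S, α * a + β * b + t = 0 → α * a = 0 ∧ β * b = 0 ∧ t = 0 := by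
  have hxy : x * y = 0 := by
    have := (hind y (-x) 0 (zero_mem _) (by ring)).1
    rwa [mul_comm] at this
  -- `x'` and `y'` generate the projections of $I$ to $Rx$ and $Ry$; `a₁` and `b₁` below are lifts
  -- of them to $I$.
  obtain ⟨x', hx'⟩ := (hx (Ideal.span {x} ⊓ (I ⊔ Ideal.span {y} ⊔ S)) inf_le_left).principal
  obtain ⟨y', hy'⟩ := (hy (Ideal.span {y} ⊓ (I ⊔ Ideal.span {x} ⊔ S)) inf_le_left).principal
  have hprojx : ∀ g ∈ I, ∀ a b, ∀ s ∈ S, g = a * x + b * y + s → ∃ α, a * x = α * x' := by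
    intro g hg a b s hs hgs
    have h1 : a * x ∈ Ideal.span {x} ⊓ (I ⊔ Ideal.span {y} ⊔ S) := by
      refine ⟨Ideal.mem_span_singleton'.2 ⟨a, rfl⟩, ?_⟩
      have h2 : a * x = g + (-b) * y + (-s) := by rw [hgs]; ring
      rw [h2]
      exact add_mem (mem_sup_left (add_mem (mem_sup_left hg)
        (mem_sup_right (Ideal.mem_span_singleton'.2 ⟨_, rfl⟩)))) (mem_sup_right (neg_mem hs))
    rw [hx'] at h1
    obtain ⟨α, hα⟩ := Ideal.mem_span_singleton'.1 h1
    exact ⟨α, hα.symm⟩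
  have hprojy : ∀ g ∈ I, ∀ a b, ∀ s ∈ S, g = a * x + b * y + s → ∃ β, b * y = β * y' := by
    intro g hg a b s hs hgs
    have h1 : b * y ∈ Ideal.span {y} ⊓ (I ⊔ Ideal.span {x} ⊔ S) := by
      refine ⟨Ideal.mem_span_singleton'.2 ⟨b, rfl⟩, ?_⟩
      have h2 : b * y = g + (-a) * x + (-s) := by rw [hgs]; ring
      rw [h2]
      exact add_mem (mem_sup_left (add_mem (mem_sup_left hg)
        (mem_sup_right (Ideal.mem_span_singleton'.2 ⟨_, rfl⟩)))) (mem_sup_right (neg_mem hs))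
    rw [hy'] at h1
    obtain ⟨β, hβ⟩ := Ideal.mem_span_singleton'.1 h1
    exact ⟨β, hβ.symm⟩
  have hx'mem : x' ∈ Ideal.span {x} ⊓ (I ⊔ Ideal.span {y} ⊔ S) :=
    hx' ▸ mem_span_singleton_self x'
  have hy'mem : y' ∈ Ideal.span {y} ⊓ (I ⊔ Ideal.span {x} ⊔ S) :=
    hy' ▸ mem_span_singleton_self y'
  obtain ⟨p, hp⟩ := Ideal.mem_span_singleton'.1 hx'mem.1
  obtain ⟨q, hq⟩ := Ideal.mem_span_singleton'.1 hy'mem.1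
  have hcomp : ∀ g ∈ I, ∃ α β, ∃ s ∈ S, g = α * x' + β * y' + s := by
    intro g hg
    obtain ⟨a, b, s, hs, hgs⟩ := hM g (hI hg)
    obtain ⟨α, hα⟩ := hprojx g hg a b s hs hgs
    obtain ⟨β, hβ⟩ := hprojy g hg a b s hs hgs
    exact ⟨α, β, s, hs, by rw [hgs, hα, hβ]⟩
  have hind' : ∀ a b, ∀ s ∈ S, a * x' + b * y' + s = 0 → a * x' = 0 ∧ b * y' = 0 ∧ s = 0 := by
    intro a b s hs h
    rw [← hp, ← hq, ← mul_assoc, ← mul_assoc] at h ⊢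
    exact hind _ _ s hs h
  obtain ⟨c, a₁, s₁, hs₁, hmem₁, heq₁⟩ : ∃ c a₁, ∃ s₁ ∈ S, a₁ ∈ I ∧ a₁ = x' + c * y' + s₁ := by
    obtain ⟨u, hu, s, hs, hus⟩ := mem_sup.1 hx'mem.2
    obtain ⟨g, hg, w, hw, hgw⟩ := mem_sup.1 hu
    obtain ⟨b, rfl⟩ := Ideal.mem_span_singleton'.1 hw
    obtain ⟨β, hβ⟩ := hprojy g hg p (-b) (-s) (neg_mem hs)
      (by rw [hp]; linear_combination hgw + hus)
    exact ⟨β, g, -s, neg_mem hs, hg, by linear_combination hgw + hus + hβ⟩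
  obtain ⟨d, b₁, s₂, hs₂, hmem₂, heq₂⟩ : ∃ d b₁, ∃ s₂ ∈ S, b₁ ∈ I ∧ b₁ = d * x' + y' + s₂ := by
    obtain ⟨u, hu, s, hs, hus⟩ := mem_sup.1 hy'mem.2
    obtain ⟨g, hg, w, hw, hgw⟩ := mem_sup.1 hu
    obtain ⟨a, rfl⟩ := Ideal.mem_span_singleton'.1 hw
    obtain ⟨α, hα⟩ := hprojx g hg (-a) q (-s) (neg_mem hs)
      (by rw [hq]; linear_combination hgw + hus)
    exact ⟨α, g, -s, neg_mem hs, hg, by linear_combination hgw + hus + hα⟩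
  have hyb : y * b₁ = y * y' := by
    rw [heq₂, ← hp]
    linear_combination d * p * hxy + hS y hym s₂ hs₂
  have hya : y * a₁ = c * (y * y') := by
    rw [heq₁, ← hp]
    linear_combination p * hxy + hS y hym s₁ hs₁
  have hmy : ∀ m ∈ maximalIdeal R, ∃ e, m * y' = e * (y * y') := by
    intro m hm
    obtain ⟨a, b, s, hs, rfl⟩ := hM m hm
    refine ⟨b, ?_⟩
    rw [← hq]
    linear_combination a * q * hxy + q * hS y hym s hs
  have hmyI : ∀ m ∈ maximalIdeal R, m * y' ∈ I := by
    intro m hm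
    obtain ⟨e, he⟩ := hmy m hm
    rw [he, ← hyb]
    exact Ideal.mul_mem_left _ _ (Ideal.mul_mem_left _ _ hmem₂)
  have hmem_max : ∀ {r z : R}, z ≠ 0 → r * z = 0 → r ∈ maximalIdeal R := fun hz h =>
    mem_maximalIdeal_of_smul_eq_zero hz h
  -- If $y'$ lifts to $I$ modulo $S$, then so does $x'$, and these lifts are `a` and `b`. Otherwise
  -- $c$ is a unit and `a₁` suffices with `b = 0`.
  by_cases hcase : ∃ s ∈ S, y' + s ∈ I
  -- When $y'=0$ the correction must be $0$: only for $y'\ne0$ does $\beta y'=0$ put $\beta$ in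
  -- $\mathcal M$, which kills $S$.
  · obtain ⟨b₂, hb₂, hb₂I, hb₂0⟩ : ∃ s ∈ S, y' + s ∈ I ∧ (y' = 0 → s = 0) := by
      by_cases h0 : y' = 0
      · exact ⟨0, zero_mem _, by simp [h0], fun _ => rfl⟩
      · obtain ⟨s, hs, h⟩ := hcase
        exact ⟨s, hs, h, fun h' => absurd h' h0⟩
    obtain ⟨a₂, ha₂, ha₂I, ha₂0⟩ : ∃ s ∈ S, x' + s ∈ I ∧ (x' = 0 → s = 0) := by
      by_cases h0 : x' = 0
      · exact ⟨0, zero_mem _, by simp [h0], fun _ => rfl⟩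
      · refine ⟨s₁ - c * b₂, sub_mem hs₁ (Ideal.mul_mem_left _ _ hb₂), ?_, fun h' => absurd h' h0⟩
        have h1 : x' + (s₁ - c * b₂) = a₁ - c * (y' + b₂) := by rw [heq₁]; ring
        rw [h1]
        exact sub_mem hmem₁ (Ideal.mul_mem_left _ _ hb₂I)
    refine ⟨x' + a₂, ha₂I, y' + b₂, hb₂I, fun g hg => ?_, fun α β t ht h => ?_⟩
    · obtain ⟨α, β, s, hs, hgs⟩ := hcomp g hg
      have h1 : g - α * (x' + a₂) - β * (y' + b₂) = s - α * a₂ - β * b₂ := by rw [hgs]; ring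
      refine ⟨α, β, g - α * (x' + a₂) - β * (y' + b₂), ⟨?_, ?_⟩, by ring⟩
      · exact sub_mem (sub_mem hg (Ideal.mul_mem_left _ _ ha₂I)) (Ideal.mul_mem_left _ _ hb₂I)
      · rw [h1]
        exact sub_mem (sub_mem hs (Ideal.mul_mem_left _ _ ha₂)) (Ideal.mul_mem_left _ _ hb₂)
    · obtain ⟨h1, h2, h3⟩ := hind' α β (α * a₂ + β * b₂ + t)
        (add_mem (add_mem (Ideal.mul_mem_left _ _ ha₂) (Ideal.mul_mem_left _ _ hb₂)) ht)
        (by linear_combination h)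
      have h4 : α * a₂ = 0 := by
        by_cases h0 : x' = 0
        · rw [ha₂0 h0, mul_zero]
        · exact hS _ (hmem_max h0 h1) _ ha₂
      have h5 : β * b₂ = 0 := by
        by_cases h0 : y' = 0
        · rw [hb₂0 h0, mul_zero]
        · exact hS _ (hmem_max h0 h2) _ hb₂
      exact ⟨by rw [mul_add, h1, h4, add_zero], by rw [mul_add, h2, h5, add_zero],
        by rwa [h4, h5, add_zero, zero_add] at h3⟩
  · have hunit : ∀ g ∈ I, ∀ r, ∀ s ∈ S, g = r * y' + s → r ∈ maximalIdeal R := by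
      intro g hg r s hs hgs
      by_contra hr
      obtain ⟨u, rfl⟩ := isUnit_of_notMem_maximalIdeal hr
      refine hcase ⟨↑u⁻¹ * s, Ideal.mul_mem_left _ _ hs, ?_⟩
      have h1 : y' + ↑u⁻¹ * s = ↑u⁻¹ * g := by
        rw [hgs, mul_add, Units.inv_mul_cancel_left]
      rw [h1]
      exact Ideal.mul_mem_left _ _ hg
    have hx0 : x' ≠ 0 := by
      intro h0
      exact hcase ⟨s₂, hs₂, by rwa [heq₂, h0, mul_zero, zero_add] at hmem₂⟩
    have hdc : 1 - d * c ∈ maximalIdeal R :=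
      hunit (b₁ - d * a₁) (sub_mem hmem₂ (Ideal.mul_mem_left _ _ hmem₁)) _ (s₂ - d * s₁)
        (sub_mem hs₂ (Ideal.mul_mem_left _ _ hs₁)) (by rw [heq₁, heq₂]; ring)
    have hcu : IsUnit c := isUnit_of_notMem_maximalIdeal fun hc =>
      one_sub_notMem (Ideal.mul_mem_left _ d hc) hdc
    obtain ⟨u, rfl⟩ := hcu
    refine ⟨a₁, hmem₁, 0, zero_mem _, fun g hg => ?_, fun α β t ht h => ?_⟩
    · obtain ⟨α, β, s, hs, hgs⟩ := hcomp g hg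
      have h1 : g - α * a₁ = (β - α * u) * y' + (s - α * s₁) := by rw [hgs, heq₁]; ring
      have h2 : s - α * s₁ ∈ S := sub_mem hs (Ideal.mul_mem_left _ _ hs₁)
      have h3 := hunit _ (sub_mem hg (Ideal.mul_mem_left _ α hmem₁)) _ _ h2 h1
      obtain ⟨e, he⟩ := hmy _ h3
      -- The remaining $y'$-part lies in $\mathcal M y'=Ryy'$, and $ya_1=u\,yy'$ with $u$ a unit, so
      -- it is a multiple of `a₁`.
      have h4 : (β - α * u) * y' = e * ↑u⁻¹ * y * a₁ := by
        rw [he, mul_assoc _ y, hya, mul_assoc, Units.inv_mul_cancel_left]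
      refine ⟨α + e * ↑u⁻¹ * y, 0, s - α * s₁, ⟨?_, h2⟩, by linear_combination h1 + h4⟩
      have h5 : s - α * s₁ = g - α * a₁ - (β - α * u) * y' := by rw [h1]; ring
      rw [h5]
      exact sub_mem (sub_mem hg (Ideal.mul_mem_left _ _ hmem₁)) (hmyI _ h3)
    · obtain ⟨h1, h2, h3⟩ := hind' α (α * u) (α * s₁ + t)
        (add_mem (Ideal.mul_mem_left _ _ hs₁) ht) (by rw [heq₁] at h; linear_combination h)
      have h4 : α * s₁ = 0 := hS _ (hmem_max hx0 h1) _ hs₁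
      exact ⟨by rw [heq₁]; linear_combination h1 + h2 + h4, by ring, by rwa [h4, zero_add] at h3⟩

theorem MaximalIdealDecomposes.exists_isDecomposition {k : ℕ} (hk : 0 < k)
    (h : MaximalIdealDecomposes R k) (I : Ideal R) :
    ∃ m ≤ k, ∃ v : Fin m → R, IsDecomposition I v := by
  -- This disposes of $I=R$ and, for $k=1$, of every ideal; afterwards $k\ge2$ and
  -- $I\subseteq\mathcal M$.
  by_cases hprinc : I.IsPrincipal
  · obtain ⟨g, rfl⟩ := hprinc
    exact ⟨1, hk, _, isDecomposition_fin_one g⟩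
  have hI : I ≤ maximalIdeal R := le_maximalIdeal fun htop => hprinc (htop ▸ inferInstance)
  obtain ⟨v₀, hv₀, hpir₀⟩ := h
  obtain _ | _ | l := k
  · exact absurd hk (lt_irrefl 0)
  · refine absurd (isPrincipalIdealRing_quotient_torsionOf_iff.1 (hpir₀ 0) I ?_) hprinc
    have h1 := (isDirectSumOf_span_singleton_iff.1 hv₀.1).2
    refine hI.trans (h1 ▸ span_mono ?_)
    rintro _ ⟨i, rfl⟩
    rw [Subsingleton.elim (α := Fin 1) i 0]
    rfl
  obtain ⟨e, he⟩ := exists_perm_of_ncard_le_two hv₀.2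
  have hv := hv₀.comp_equiv e
  have hpir := fun i => hpir₀ (e i)
  obtain ⟨hvi, hvs⟩ := isDirectSumOf_span_singleton_iff.1 hv.1
  let v := v₀ ∘ e
  let s : Fin l → R := fun i => v i.succ.succ
  have hsimple : ∀ m ∈ maximalIdeal R, ∀ i, m * s i = 0 := by
    intro m hm i
    refine (isSimpleModule_span_singleton_iff.1 (not_not.1 fun hns => ?_)).2 m hm
    rcases he i.succ.succ hns with h | h
    · exact Fin.succ_ne_zero _ h
    · exact Fin.succ_ne_zero _ (Fin.succ_injective _ h)
  have hvm : ∀ i, v i ∈ maximalIdeal R := fun i => hvs ▸ subset_span ⟨i, rfl⟩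
  obtain ⟨a, ha, b, hb, hgen, hind⟩ :=
    exists_decomposition_of_le_maximalIdeal (x := v 0) (y := v 1) (S := span R (Set.range s))
      (I := I)
      (fun m hm => by
        obtain ⟨c, hc⟩ := (mem_span_range_iff_exists_fun R).1 (hvs.symm ▸ hm)
        refine ⟨c 0, c 1, ∑ i : Fin l, c i.succ.succ • s i,
          sum_mem fun i _ => smul_mem _ _ (subset_span ⟨i, rfl⟩), ?_⟩
        rw [← hc, Fin.sum_univ_succ, Fin.sum_univ_succ, ← add_assoc]
        rfl)
      (fun a b t ht h => by
        obtain ⟨c, rfl⟩ := (mem_span_range_iff_exists_fun R).1 ht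
        have h1 := cyclicIndep_iff_fintype.1 hvi (Fin.cons a (Fin.cons b c)) (by
          rw [Fin.sum_univ_succ, Fin.sum_univ_succ, ← add_assoc]
          exact h)
        exact ⟨h1 0, h1 1, Finset.sum_eq_zero fun i _ => h1 i.succ.succ⟩)
      (fun m hm t ht => by
        obtain ⟨c, rfl⟩ := (mem_span_range_iff_exists_fun R).1 ht
        rw [Finset.mul_sum]
        exact Finset.sum_eq_zero fun i _ => by
          rw [smul_eq_mul, mul_left_comm, hsimple m hm, mul_zero])
      (hvm 1) (isPrincipalIdealRing_quotient_torsionOf_iff.1 (hpir 0))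
      (isPrincipalIdealRing_quotient_torsionOf_iff.1 (hpir 1)) hI
  obtain ⟨l', hl', t, ht0, ht, hts⟩ :=
    exists_cyclicIndep_of_mul_eq_zero (T := I ⊓ span R (Set.range s)) inf_le_right hsimple
  have htmem : ∀ i, t i ∈ I ⊓ span R (Set.range s) := fun i => hts ▸ subset_span ⟨i, rfl⟩
  let w : Fin (l' + 2) → R := Fin.cons a (Fin.cons b t)
  have hwsum : ∀ c : Fin (l' + 2) → R,
      ∑ i, c i • w i = c 0 * a + c 1 * b + ∑ i : Fin l', c i.succ.succ • t i := by
    intro c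
    rw [Fin.sum_univ_succ, Fin.sum_univ_succ, ← add_assoc]
    rfl
  refine ⟨l' + 2, by lia, w, isDirectSumOf_span_singleton_iff.2
    ⟨cyclicIndep_iff_fintype.2 fun c hc => ?_, le_antisymm (span_le.2 ?_) fun g hg => ?_⟩, ?_⟩
  · rw [hwsum] at hc
    obtain ⟨h1, h2, h3⟩ := hind _ _ _ (sum_mem fun i _ => smul_mem _ _ (htmem i).2) hc
    have h4 := cyclicIndep_iff_fintype.1 ht _ h3
    exact Fin.cases h1 (Fin.cases h2 h4)
  · rintro _ ⟨i, rfl⟩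
    exact Fin.cases ha (Fin.cases hb fun i => (htmem i).1) i
  · obtain ⟨α, β, g', hg', rfl⟩ := hgen g hg
    obtain ⟨c, rfl⟩ := (mem_span_range_iff_exists_fun R).1 (hts.symm ▸ hg')
    exact (mem_span_range_iff_exists_fun R).2 ⟨Fin.cons α (Fin.cons β c), hwsum _⟩
  -- The `t i` are nonzero and killed by $\mathcal M$, so only positions 0 and 1 can fail to be
  -- simple.
  · refine (Set.ncard_le_ncard (t := {0, 1}) ?_ (Set.toFinite _)).trans
      ((Set.ncard_insert_le _ _).trans (by simp))
    refine Fin.cases (fun _ => .inl rfl) (Fin.cases (fun _ => .inr rfl) fun i hi => ?_)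
    refine absurd (isSimpleModule_span_singleton_iff.2 ⟨ht0 i, fun m hm => ?_⟩) hi
    obtain ⟨c, hc⟩ := (mem_span_range_iff_exists_fun R).1 (htmem i).2
    rw [← hc, Finset.mul_sum]
    exact Finset.sum_eq_zero fun j _ => by
      rw [smul_eq_mul, mul_left_comm, hsimple m hm, mul_zero]

end Decomposition

/-! ### Equivalences with a fixed bound -/

section Equivalences

variable {R : Type*} [CommRing R]

theorem IsDecomposition.isDirectSumOfAtMostCyclics {I : Ideal R} {m n : ℕ} {v : Fin m → R}
    (h : IsDecomposition I v) (hm : m ≤ n) : IsDirectSumOfAtMostCyclics R n I :=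
  have h1 := isDirectSumOf_span_singleton_iff.1 h.1
  .submodule_of_cyclicIndep (by simpa using hm) h1.1 h1.2

variable [IsLocalRing R]

theorem maximalIdealDecomposes_of_isDirectSumOfAtMostCyclics {n : ℕ} (hn : 0 < n)
    (h : ∀ I : Ideal R, IsDirectSumOfAtMostCyclics R n I) :
    ∃ k, 0 < k ∧ k ≤ n ∧ MaximalIdealDecomposes R k := by
  obtain ⟨m, hm, v, -, hv⟩ := (h (maximalIdeal R)).exists_submodule_cyclicIndep
  obtain ⟨k, hk0, hk, hd⟩ := maximalIdealDecomposes_of_isDirectSumOfCyclics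
    (fun I => (h I).isDirectSumOfCyclics) hv
  exact ⟨k, hk0, hk.trans (max_le hm hn), hd⟩

theorem tfae_of_pos {n : ℕ} (hn : 0 < n) :
    List.TFAE [
      ∃ k : ℕ, 0 < k ∧ k ≤ n ∧ MaximalIdealDecomposes R k,
      ∀ I : Ideal R, ∃ m ≤ n, ∃ v : Fin m → R, IsDecomposition I v,
      ∀ I : Ideal R, IsDirectSumOfAtMostCyclics R n I,
      ∀ I : Ideal R, IsSummandOfAtMostCyclics R n I] := by
  tfae_have 1 → 2 := fun ⟨k, hk0, hk, h⟩ I =>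
    let ⟨m, hm, v, hv⟩ := h.exists_isDecomposition hk0 I
    ⟨m, hm.trans hk, v, hv⟩
  tfae_have 2 → 3 := fun h I =>
    let ⟨_, hm, _, hv⟩ := h I
    hv.isDirectSumOfAtMostCyclics hm
  tfae_have 3 → 4 := fun h I => (h I).isSummandOfAtMostCyclics
  tfae_have 4 → 3 := fun h I => (h I).isDirectSumOfAtMostCyclics
  tfae_have 3 → 1 := maximalIdealDecomposes_of_isDirectSumOfAtMostCyclics hn
  tfae_finish

end Equivalences

end CyclicDecompositions

theorem corollary3p8 (R : Type*) [CommRing R] [IsLocalRing R] :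
    List.TFAE [
      (IsLocalRing.maximalIdeal R).FG ∧ ∀ I : Ideal R, IsDirectSumOfCyclics R I,
      IsNoetherianRing R ∧ ∀ I : Ideal R, IsDirectSumOfCyclics R I,
      ∃ n : ℕ, 0 < n ∧ MaximalIdealDecomposes R n,
      ∃ n : ℕ, 0 < n ∧ ∀ I : Ideal R, ∃ m ≤ n, ∃ v : Fin m → R, IsDecomposition I v,
      ∃ n : ℕ, 0 < n ∧ ∀ I : Ideal R, IsDirectSumOfAtMostCyclics R n I,
      ∃ n : ℕ, 0 < n ∧ ∀ I : Ideal R, IsSummandOfAtMostCyclics R n I] ∧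
    ∀ n : ℕ, 0 < n →
      List.TFAE [
        ∃ k : ℕ, 0 < k ∧ k ≤ n ∧ MaximalIdealDecomposes R k,
        ∀ I : Ideal R, ∃ m ≤ n, ∃ v : Fin m → R, IsDecomposition I v,
        ∀ I : Ideal R, IsDirectSumOfAtMostCyclics R n I,
        ∀ I : Ideal R, IsSummandOfAtMostCyclics R n I] ∧
      ((∀ I : Ideal R, IsDirectSumOfAtMostCyclics R n I) →
        ∀ (I : Ideal R) (ι : Type*) (v : ι → R), (∀ i, v i ≠ 0) →
          IsDirectSumOf I (fun i => Ideal.span {v i}) → Finite ι ∧ Nat.card ι ≤ n) := by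
  refine ⟨?_, fun n hn => ⟨tfae_of_pos hn, fun h I ι v hv0 hv => ?_⟩⟩
  · tfae_have 1 → 3 := by
      rintro ⟨hfg, h⟩
      obtain ⟨n, w, hw⟩ := Submodule.fg_iff_exists_fin_generating_family.1 hfg
      obtain ⟨k, hk0, -, hk⟩ := maximalIdealDecomposes_of_isDirectSumOfCyclics h hw
      exact ⟨k, hk0, hk⟩
    tfae_have 3 → 4 := fun ⟨n, hn, h⟩ =>
      ⟨n, hn, ((tfae_of_pos (R := R) hn).out 0 1 :).1 ⟨n, hn, le_rfl, h⟩⟩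
    tfae_have 4 → 5 := fun ⟨n, hn, h⟩ => ⟨n, hn, ((tfae_of_pos (R := R) hn).out 1 2 :).1 h⟩
    tfae_have 5 → 6 := fun ⟨n, hn, h⟩ => ⟨n, hn, ((tfae_of_pos (R := R) hn).out 2 3 :).1 h⟩
    tfae_have 6 → 5 := fun ⟨n, hn, h⟩ => ⟨n, hn, ((tfae_of_pos (R := R) hn).out 2 3 :).2 h⟩
    tfae_have 5 → 2 := fun ⟨n, hn, h⟩ =>
      ⟨(isNoetherianRing_iff_ideal_fg R).2 fun I => Module.Finite.iff_fg.1 (h I).finite,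
        fun I => (h I).isDirectSumOfCyclics⟩
    tfae_have 2 → 1 := fun ⟨hR, h⟩ => ⟨(isNoetherianRing_iff_ideal_fg R).1 hR _, h⟩
    tfae_finish
  · obtain ⟨hvi, hvs⟩ := isDirectSumOf_span_singleton_iff.1 hv
    obtain ⟨m, hm, w, -, hw⟩ := (h I).exists_submodule_cyclicIndep
    obtain ⟨hfin, hcard⟩ := hvi.finite_card_le hv0 (hvs.trans hw.symm)
    exact ⟨hfin, hcard.trans hm⟩
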